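/- Let $n\ge 4$. State vectors are elements of $(\mathbb{C}^d)^{\otimes n}$ and need not be normalized. The SLOCC class of $|\psi\rangle$ is $\{(g_1\otimes\cdots\otimes g_n)|\psi\rangle : g_k\in GL(d,\mathbb{C})\}$, and its symmetry group $\mathcal{S}_\psi$ is the set of all operators $S_1\otimes\cdots\otimes S_n$ with $S_k\in GL(d,\mathbb{C})$ that satisfy $(S_1\otimes\cdots\otimes S_n)|\psi\rangle=|\psi\rangle$. In one round of an LOCC protocol one party performs a measurement on its qudit, with finitely many outcomes and operators $A_1,\dots,A_m\in\mathbb{C}^{d\times d}$, $\sum_k A_k^\dagger A_k=\mathbb{1}$, and communicates the outcome, after which each of the other parties applies a unitary to its qudit that may depend on the outcome. In a protocol with several rounds each round may depend on all earlier outcomes, and the protocol transforms $|\psi\rangle$ into $|\phi\rangle$ if every branch of nonzero probability ends in a nonzero multiple of $|\phi\rangle$. Two states are LU-equivalent if they are related by local unitaries $U_1\otimes\cdots\otimes U_n$ up to a nonzero scalar. A state $|\phi\rangle$ is called weakly isolated if no state in its SLOCC class that is not LU-equivalent to $|\phi\rangle$ can be transformed into $|\phi\rangle$ by an LOCC protocol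 with finitely many rounds, and $|\phi\rangle$ cannot be transformed by a one-round LOCC protocol into any state in its SLOCC class that is not LU-equivalent to $|\phi\rangle$. (1) Let $d\ge 2$, and let $|\Psi_s\rangle\in(\mathbb{C}^d)^{\otimes n}$ be an $n$-qudit state with $\mathcal{S}_{\Psi_s}\subseteq\{S^{\otimes n} : S\in GL(d,\mathbb{C})\}$. Then the SLOCC class of $|\Psi_s\rangle$ contains a weakly isolated state. (2) In particular, for every $n\geq 4$ the SLOCC class of the totally antisymmetric state $|A_n\rangle=\frac{1}{\sqrt{n!}}\sum_{\pi}\mathrm{sgn}(\pi)\,|\pi(1),\dots,\pi(n)\rangle\in(\mathbb{C}^n)^{\otimes n}$, where the sum is over all permutations $\pi$ of $\{1,\dots,n\}$, contains a weakly isolated state. -/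

import Mathlib

open scoped Matrix

noncomputable section

/-- An (unnormalized) pure state vector of `n` qudits of local dimension `d`, i.e. an element of
`(ℂ^d)^{⊗ n}`, given by its coefficients in the product basis `|x₁, …, xₙ⟩`. -/
abbrev QState (n d : ℕ) : Type := (Fin n → Fin d) → ℂ

/-- The matrix of the local operator `A₁ ⊗ ⋯ ⊗ Aₙ` in the product basis. -/
def localOp {n d : ℕ} (A : Fin n → Matrix (Fin d) (Fin d) ℂ) :
    Matrix (Fin n → Fin d) (Fin n → Fin d) ℂ :=
  Matrix.of fun x y => ∏ k, A k (x k) (y k)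

/-- The SLOCC class `{(g₁ ⊗ ⋯ ⊗ gₙ) ψ : gₖ ∈ GL(d, ℂ)}` of `ψ`. -/
def sloccClass {n d : ℕ} (ψ : QState n d) : Set (QState n d) :=
  {φ | ∃ g : Fin n → GL (Fin d) ℂ,
    φ = localOp (fun k => (g k : Matrix (Fin d) (Fin d) ℂ)) *ᵥ ψ}

/-- The stabilizer (symmetry group) of `ψ`: the invertible local operators `S₁ ⊗ ⋯ ⊗ Sₙ`
(as operators on the whole space) with `(S₁ ⊗ ⋯ ⊗ Sₙ) ψ = ψ`. -/
def symmetryGroup {n d : ℕ} (ψ : QState n d) :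
    Set (Matrix (Fin n → Fin d) (Fin n → Fin d) ℂ) :=
  {T | (∃ S : Fin n → GL (Fin d) ℂ,
      T = localOp (fun k => (S k : Matrix (Fin d) (Fin d) ℂ))) ∧ T *ᵥ ψ = ψ}

/-- The operators of the form `S ⊗ S ⊗ ⋯ ⊗ S` (`n` factors) with `S ∈ GL(d, ℂ)`. -/
def tensorPowers (n d : ℕ) : Set (Matrix (Fin n → Fin d) (Fin n → Fin d) ℂ) :=
  {T | ∃ S : GL (Fin d) ℂ, T = localOp (fun _ => (S : Matrix (Fin d) (Fin d) ℂ))}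

/-- `ψ` and `φ` represent local-unitary equivalent states (state vectors are not normalized, so a
nonzero scalar factor is irrelevant). -/
def LUEquivalent {n d : ℕ} (ψ φ : QState n d) : Prop :=
  ∃ (U : Fin n → Matrix.unitaryGroup (Fin d) ℂ) (c : ℂ), c ≠ 0 ∧
    localOp (fun k => (U k : Matrix (Fin d) (Fin d) ℂ)) *ᵥ ψ = c • φ

/-- One round of an LOCC protocol: one party performs a local measurement with finitely many
outcomes and broadcasts the outcome; every other party applies a local unitary that depends on
this outcome. -/
structure LOCCRound (n d : ℕ) where
  /-- the party that measures -/
  party : Fin n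
  /-- the number of outcomes -/
  outcomes : ℕ
  /-- the measurement operators -/
  kraus : Fin outcomes → Matrix (Fin d) (Fin d) ℂ
  /-- completeness of the measurement -/
  complete : ∑ k, (kraus k)ᴴ * kraus k = 1
  /-- the local unitaries; the entry of the measuring party is not used -/
  corrections : Fin outcomes → Fin n → Matrix.unitaryGroup (Fin d) ℂ

/-- The (unnormalized) state after outcome `k` of a round performed on `ψ`. It is the zero vector
exactly if the outcome has probability zero. -/
def LOCCRound.post {n d : ℕ} (R : LOCCRound n d) (k : Fin R.outcomes) (ψ : QState n d) :
    QState n d :=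
  localOp (Function.update
    (fun j => (R.corrections k j : Matrix (Fin d) (Fin d) ℂ)) R.party (R.kraus k)) *ᵥ ψ

/-- `LOCCTransforms N ψ φ`: an LOCC protocol with `N` rounds transforms `ψ` into `φ`
deterministically. Each round may depend on all the previous outcomes, and at the end of
each branch of nonzero probability the state is `φ` up to a scalar factor. -/
def LOCCTransforms {n d : ℕ} : ℕ → QState n d → QState n d → Prop
  | 0, ψ, φ => ∃ c : ℂ, ψ = c • φ
  | N + 1, ψ, φ => ∃ R : LOCCRound n d, ∀ k, LOCCTransforms N (R.post k ψ) φ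

/-- `φ` can be reached with a finite-round LOCC protocol from an SLOCC-equivalent state that is
not LU-equivalent to it. -/
def IsLOCCReachable {n d : ℕ} (φ : QState n d) : Prop :=
  ∃ ψ ∈ sloccClass φ, ¬ LUEquivalent ψ φ ∧ ∃ N : ℕ, LOCCTransforms N ψ φ

/-- `φ` can be converted with a one-round LOCC protocol into an SLOCC-equivalent state that is
not LU-equivalent to it. -/
def IsOneRoundConvertible {n d : ℕ} (φ : QState n d) : Prop :=
  ∃ χ ∈ sloccClass φ, ¬ LUEquivalent φ χ ∧ LOCCTransforms 1 φ χ

/-- A state is weakly isolated if it is neither reachable by finite-round LOCC nor convertible by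
one-round LOCC. -/
def IsWeaklyIsolated {n d : ℕ} (φ : QState n d) : Prop :=
  ¬ IsLOCCReachable φ ∧ ¬ IsOneRoundConvertible φ

/-- The totally antisymmetric state
`|Aₙ⟩ = (1/√n!) ∑_π sgn(π) |π(1), …, π(n)⟩` of `n` qudits of local dimension `n`. -/
def antisymmetricState (n : ℕ) : QState n n :=
  ((1 / Real.sqrt (n.factorial : ℝ) : ℝ) : ℂ) •
    ∑ π : Equiv.Perm (Fin n), (((Equiv.Perm.sign π : ℤˣ) : ℤ) : ℂ) • Pi.single (⇑π) (1 : ℂ)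

end

/-!
Write `G k = (g k)ᴴ * g k` for a local operator `g₁ ⊗ ⋯ ⊗ gₙ` applied to `ψ`, and `φ` for the
resulting state. Up to scalars, the local symmetries of `φ` are the operators
`(g k) * S * (g k)⁻¹` with a single `S`, and such an operator is a multiple of a unitary at party
`k` exactly if `S` preserves the positive definite form `G k` up to a factor. A determinant
comparison shows that this factor does not depend on `k`. Take four of the `G k` to be `1`, `D`,
`1 + J` and `1 + D + (1 + J)`, where `D` is diagonal with distinct positive entries and `J` is the
all-ones matrix, so that any three of them span the same space. If `S` preserves all `G k` but
one, up to a common factor, then it preserves `1`, `D` and `J` up to that factor; hence it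
commutes with `D` and `J` and is scalar (`exists_posDef_family`). This is where four parties are
needed. So `φ` is rigid (`IsRigid`): a local operator that fixes `φ` up to a nonzero scalar and is
unitary at all parties but one is scalar at the remaining one
(`exists_isRigid_mem_sloccClass`).

Rigid states are weakly isolated. Rigidity forces full local rank, so a measurement operator in a
protocol from or to `φ` inside its SLOCC class is either zero or invertible
(`IsRigid.isUnit`, `IsRigid.mulVec_ne_zero`). Two outcomes of a round that both lead to the same
state, up to local unitaries, differ by a local symmetry of `φ` that is unitary at all parties but
the measuring one; by rigidity the two measurement operators agree up to a unitary and a scalar.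
Completeness then makes all of them multiples of unitaries, and the round is a local unitary. For
finitely many rounds one inducts on their number, starting at the end of the protocol.

The antisymmetric state falls under the general case. Exchanging two tensor factors of a symmetry
gives a symmetry again, so `(S i)⁻¹ * S j` acts in the same way at the parties `i` and `j`, and
evaluating this at suitable basis vectors shows that it is scalar
(`exists_eq_smul_one_of_antisymmetricState`).
-/

/-! ### Local operators -/

theorem localOp_mul {n d : ℕ} (A B : Fin n → Matrix (Fin d) (Fin d) ℂ) :
    localOp A * localOp B = localOp (fun k => A k * B k) := by
  ext x y
  simp only [localOp, Matrix.mul_apply, Matrix.of_apply, Finset.prod_univ_sum,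
    Fintype.piFinset_univ, Finset.prod_mul_distrib]

theorem localOp_mulVec_mulVec {n d : ℕ} (A B : Fin n → Matrix (Fin d) (Fin d) ℂ)
    (φ : QState n d) :
    localOp A *ᵥ (localOp B *ᵥ φ) = localOp (fun k => A k * B k) *ᵥ φ := by
  rw [Matrix.mulVec_mulVec, localOp_mul]

theorem localOp_one {n d : ℕ} : localOp (fun _ : Fin n => (1 : Matrix (Fin d) (Fin d) ℂ)) = 1 := by
  ext x y
  simp only [localOp, Matrix.of_apply, Matrix.one_apply]
  rw [Finset.prod_ite_zero]
  simp [funext_iff]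

theorem localOp_smul {n d : ℕ} (c : Fin n → ℂ) (A : Fin n → Matrix (Fin d) (Fin d) ℂ) :
    localOp (fun k => c k • A k) = (∏ k, c k) • localOp A := by
  ext x y
  simp [localOp, Finset.prod_mul_distrib]

theorem localOp_eq_zero {n d : ℕ} {A : Fin n → Matrix (Fin d) (Fin d) ℂ} (p : Fin n)
    (h : A p = 0) : localOp A = 0 := by
  ext x y
  simp only [localOp, Matrix.of_apply, Matrix.zero_apply]
  exact Finset.prod_eq_zero (Finset.mem_univ p) (by simp [h])

theorem localOp_inv_mulVec {n d : ℕ} {A : Fin n → Matrix (Fin d) (Fin d) ℂ}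
    (hA : ∀ k, IsUnit (A k)) (φ : QState n d) :
    localOp (fun k => (A k)⁻¹) *ᵥ (localOp A *ᵥ φ) = φ := by
  rw [localOp_mulVec_mulVec]
  have : (fun k => (A k)⁻¹ * A k) = fun _ => 1 := by
    funext k
    exact Matrix.nonsing_inv_mul _ ((Matrix.isUnit_iff_isUnit_det _).1 (hA k))
  rw [this, localOp_one, Matrix.one_mulVec]

theorem localOp_mulVec_injective {n d : ℕ} {A : Fin n → Matrix (Fin d) (Fin d) ℂ}
    (hA : ∀ k, IsUnit (A k)) {φ χ : QState n d} (h : localOp A *ᵥ φ = localOp A *ᵥ χ) : φ = χ := by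
  rw [← localOp_inv_mulVec hA φ, h, localOp_inv_mulVec hA χ]

/-- The tensor factors of an invertible local operator are unique up to scalars. -/
theorem exists_smul_of_localOp_eq {n d : ℕ} (hd : 0 < d)
    {A B : Fin n → Matrix (Fin d) (Fin d) ℂ}
    (hA : ∀ k, IsUnit (A k)) (h : localOp A = localOp B) (k : Fin n) :
    ∃ a : ℂ, a ≠ 0 ∧ A k = a • B k := by
  have : Nonempty (Fin d) := ⟨⟨0, hd⟩⟩
  have hne : ∀ j, ∃ x y, A j x y ≠ 0 := by
    intro j
    by_contra! hj
    exact (hA j).ne_zero (Matrix.ext hj)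
  choose x y hxy using hne
  have key : ∀ u v, A k u v * ∏ j ∈ Finset.univ.erase k, A j (x j) (y j)
      = B k u v * ∏ j ∈ Finset.univ.erase k, B j (x j) (y j) := by
    intro u v
    have := congrFun (congrFun h (Function.update x k u)) (Function.update y k v)
    simp only [localOp, Matrix.of_apply] at this
    rw [← Finset.mul_prod_erase _ _ (Finset.mem_univ k),
      ← Finset.mul_prod_erase _ _ (Finset.mem_univ k)] at this
    simp only [Function.update_self] at this
    rw [Finset.prod_congr rfl fun j hj => by
        rw [Function.update_of_ne (Finset.ne_of_mem_erase hj),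
          Function.update_of_ne (Finset.ne_of_mem_erase hj)],
      Finset.prod_congr (f := fun j => B j (Function.update x k u j) (Function.update y k v j))
        rfl fun j hj => by
        rw [Function.update_of_ne (Finset.ne_of_mem_erase hj),
          Function.update_of_ne (Finset.ne_of_mem_erase hj)]] at this
    exact this
  have hP : ∏ j ∈ Finset.univ.erase k, A j (x j) (y j) ≠ 0 :=
    Finset.prod_ne_zero_iff.2 fun j _ => hxy j
  have hk : A k = ((∏ j ∈ Finset.univ.erase k, B j (x j) (y j)) /
      ∏ j ∈ Finset.univ.erase k, A j (x j) (y j)) • B k := by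
    ext u v
    rw [Matrix.smul_apply, smul_eq_mul, div_mul_eq_mul_div, eq_div_iff hP, key, mul_comm]
  refine ⟨_, ?_, hk⟩
  intro h0
  rw [h0, zero_smul] at hk
  exact (hA k).ne_zero hk

/-! ### Rigid states -/

/-- A state is rigid if a local operator that fixes it up to a nonzero scalar, is unitary at all
parties but `p` and invertible at `p`, is a multiple of the identity at `p`. -/
def IsRigid {n d : ℕ} (φ : QState n d) : Prop :=
  ∀ (T : Fin n → Matrix (Fin d) (Fin d) ℂ) (p : Fin n) (c : ℂ), c ≠ 0 →
    (∀ k ≠ p, T k ∈ Matrix.unitaryGroup (Fin d) ℂ) → IsUnit (T p) →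
    localOp T *ᵥ φ = c • φ → ∃ a : ℂ, T p = a • 1

/-- A rigid state has full local rank at every party. -/
theorem IsRigid.eq_zero_of_mulVec_eq_zero {n d : ℕ} (hd : 2 ≤ d) {φ : QState n d} (hφ : IsRigid φ)
    (p : Fin n) (B : Matrix (Fin d) (Fin d) ℂ)
    (hB : localOp (Function.update (fun _ => 1) p B) *ᵥ φ = 0) : B = 0 := by
  by_contra hne
  obtain ⟨r, j, hrj⟩ : ∃ r j, B r j ≠ 0 := by
    by_contra! h
    exact hne (Matrix.ext h)
  have : Nontrivial (Fin d) := Fin.nontrivial_iff_two_le.2 hd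
  obtain ⟨i, hij⟩ := exists_ne j
  -- A sign `t` makes the transvection-like matrix `1 + t eᵢ wᵀ`, `w` the `r`-th row of `B`,
  -- invertible; it fixes `φ` but has a nonzero off-diagonal entry.
  obtain ⟨t, ht, hdet⟩ : ∃ t : ℂ, t ≠ 0 ∧ 1 + B r i * t ≠ 0 := by
    by_cases h : 1 + B r i * 1 = 0
    · refine ⟨-1, by norm_num, fun h' => ?_⟩
      have : (2 : ℂ) = 0 := by linear_combination h + h'
      norm_num at this
    · exact ⟨1, one_ne_zero, h⟩
  set N : Matrix (Fin d) (Fin d) ℂ := Matrix.single i r t * B with hN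
  have hNe : N = Matrix.replicateCol Unit (Pi.single i t) * Matrix.replicateRow Unit (B r) := by
    ext a b
    by_cases ha : a = i
    · subst ha; simp [hN, Matrix.mul_apply, Matrix.single_apply]
    · simp [hN, Matrix.mul_apply, ha, Ne.symm ha]
  have hunit : IsUnit (1 + N) := by
    rw [Matrix.isUnit_iff_isUnit_det, hNe, Matrix.det_one_add_replicateCol_mul_replicateRow,
      isUnit_iff_ne_zero]
    simpa using hdet
  have hNφ : localOp (Function.update (fun _ => 1) p N) *ᵥ φ = 0 := by
    have : Function.update (fun _ => (1 : Matrix (Fin d) (Fin d) ℂ)) p N =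
        fun k => Function.update (fun _ => 1) p (Matrix.single i r t) k *
          Function.update (fun _ => 1) p B k := by
      funext k
      by_cases hk : k = p
      · subst hk; simp [hN]
      · simp [hk]
    rw [this, ← localOp_mulVec_mulVec, hB, Matrix.mulVec_zero]
  have hadd : localOp (Function.update (fun _ => 1) p (1 + N)) =
      1 + localOp (Function.update (fun _ => 1) p N) := by
    rw [← localOp_one]
    ext x y
    simp only [localOp, Matrix.of_apply, Matrix.add_apply]
    simp only [← Finset.mul_prod_erase _ _ (Finset.mem_univ p), Function.update_self]
    rw [Finset.prod_congr rfl fun k hk => by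
        rw [Function.update_of_ne (Finset.ne_of_mem_erase hk)],
      Finset.prod_congr (f := fun k => Function.update (fun _ => (1 : Matrix (Fin d) (Fin d) ℂ)) p N k (x k) (y k))
        rfl fun k hk => by rw [Function.update_of_ne (Finset.ne_of_mem_erase hk)]]
    rw [Matrix.add_apply, add_mul]
  obtain ⟨a, ha⟩ := hφ (Function.update (fun _ => 1) p (1 + N)) p 1 one_ne_zero
    (fun k hk => by rw [Function.update_of_ne hk]; exact one_mem _) (by simpa using hunit)
    (by rw [hadd, Matrix.add_mulVec, hNφ]; simp)
  have := congrFun (congrFun ha i) j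
  simp [hN, Matrix.mul_apply, Matrix.single_apply, hij, ht, hrj] at this

/-- A local operator that sends a rigid state to a nonzero multiple of itself is invertible at
every party. -/
theorem IsRigid.isUnit {n d : ℕ} (hd : 2 ≤ d) {φ : QState n d} (hφ : IsRigid φ)
    {T : Fin n → Matrix (Fin d) (Fin d) ℂ} {c : ℂ} (hc : c ≠ 0)
    (h : localOp T *ᵥ φ = c • φ) (p : Fin n) : IsUnit (T p) := by
  rw [Matrix.isUnit_iff_isUnit_det, isUnit_iff_ne_zero]
  intro hdet
  obtain ⟨v, hv, hvT⟩ := Matrix.exists_vecMul_eq_zero_iff.2 hdet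
  have : Nonempty (Fin d) := ⟨⟨0, by omega⟩⟩
  have hB := hφ.eq_zero_of_mulVec_eq_zero hd p (Matrix.of fun _ => v) (by
    have h1 : localOp (Function.update (fun _ => 1) p (Matrix.of fun _ => v)) *ᵥ (c • φ) = 0 := by
      rw [← h, localOp_mulVec_mulVec, localOp_eq_zero p, Matrix.zero_mulVec]
      ext a b
      simpa [Matrix.vecMul, dotProduct, Matrix.mul_apply] using congrFun hvT b
    rw [Matrix.mulVec_smul] at h1
    exact (smul_eq_zero.1 h1).resolve_left hc)
  apply hv
  funext b
  exact congrFun (congrFun hB (Classical.arbitrary _)) b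

/-- A local operator that is invertible at all parties but one and nonzero there does not kill a
rigid state: outcomes of nonzero measurement operators have nonzero probability. -/
theorem IsRigid.mulVec_ne_zero {n d : ℕ} (hd : 2 ≤ d) {φ : QState n d} (hφ : IsRigid φ)
    {T : Fin n → Matrix (Fin d) (Fin d) ℂ} (p : Fin n) (hT : ∀ k ≠ p, IsUnit (T k))
    (hp : T p ≠ 0) : localOp T *ᵥ φ ≠ 0 := by
  intro h
  apply hp
  apply hφ.eq_zero_of_mulVec_eq_zero hd p
  have : Function.update (fun _ => 1) p (T p) =
      fun k => Function.update (fun k => (T k)⁻¹) p 1 k * T k := by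
    funext k
    by_cases hk : k = p
    · subst hk; simp
    · simp only [Function.update_of_ne hk]
      exact (Matrix.nonsing_inv_mul _ ((Matrix.isUnit_iff_isUnit_det _).1 (hT k hk))).symm
  rw [this, ← localOp_mulVec_mulVec, h, Matrix.mulVec_zero]

/-- Rigidity for two local symmetries that differ by unitaries on the left. It is applied to
outcomes that lead to `φ`, where the unitaries are the corrections. -/
theorem IsRigid.exists_smul_of_left {n d : ℕ} (hd : 2 ≤ d) {φ : QState n d} (hφ : IsRigid φ)
    {P Q : Fin n → Matrix (Fin d) (Fin d) ℂ} {b c : ℂ} (hb : b ≠ 0) (hc : c ≠ 0)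
    (hP : localOp P *ᵥ φ = b • φ) (hQ : localOp Q *ᵥ φ = c • φ) (p : Fin n)
    (W : Fin n → Matrix.unitaryGroup (Fin d) ℂ)
    (hW : ∀ k ≠ p, P k = W k * Q k) : ∃ a : ℂ, P p = a • Q p := by
  have hQp := (Matrix.isUnit_iff_isUnit_det _).1 (hφ.isUnit hd hc hQ p)
  have hQi := (Matrix.isUnit_nonsing_inv_iff).2 (hφ.isUnit hd hc hQ p)
  obtain ⟨a, ha⟩ := hφ
    (Function.update (fun k => (W k : Matrix (Fin d) (Fin d) ℂ)) p (P p * (Q p)⁻¹)) p (b / c)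
    (div_ne_zero hb hc) (fun k hk => by rw [Function.update_of_ne hk]; exact (W k).2)
    (by rw [Function.update_self]; exact (hφ.isUnit hd hb hP p).mul hQi) (by
      have h1 : φ = c⁻¹ • (localOp Q *ᵥ φ) := by rw [hQ, smul_smul, inv_mul_cancel₀ hc, one_smul]
      conv_lhs => rw [h1]
      rw [Matrix.mulVec_smul, localOp_mulVec_mulVec]
      have : (fun k => Function.update (fun k => (W k : Matrix (Fin d) (Fin d) ℂ)) p
          (P p * (Q p)⁻¹) k * Q k) = P := by
        funext k
        by_cases hk : k = p
        · subst hk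
          rw [Function.update_self, Matrix.nonsing_inv_mul_cancel_right _ _ hQp]
        · rw [Function.update_of_ne hk, hW k hk]
      rw [this, hP, smul_smul, div_eq_inv_mul])
  refine ⟨a, ?_⟩
  rw [Function.update_self] at ha
  rw [← Matrix.nonsing_inv_mul_cancel_right _ (P p) hQp, ha, smul_mul_assoc, one_mul]

/-- Rigidity for two local symmetries that differ by unitaries on the right. It is applied to
outcomes of a round performed on `φ`. -/
theorem IsRigid.exists_smul_of_right {n d : ℕ} (hd : 2 ≤ d) {φ : QState n d} (hφ : IsRigid φ)
    {P Q : Fin n → Matrix (Fin d) (Fin d) ℂ} {b c : ℂ} (hb : b ≠ 0) (hc : c ≠ 0)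
    (hP : localOp P *ᵥ φ = b • φ) (hQ : localOp Q *ᵥ φ = c • φ) (p : Fin n)
    (W : Fin n → Matrix.unitaryGroup (Fin d) ℂ)
    (hW : ∀ k ≠ p, P k = Q k * W k) : ∃ a : ℂ, P p = a • Q p := by
  have hQu := hφ.isUnit hd hc hQ
  have hQp := (Matrix.isUnit_iff_isUnit_det _).1 (hQu p)
  have hQi := (Matrix.isUnit_nonsing_inv_iff).2 (hQu p)
  obtain ⟨a, ha⟩ := hφ
    (Function.update (fun k => (W k : Matrix (Fin d) (Fin d) ℂ)) p ((Q p)⁻¹ * P p)) p (b / c)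
    (div_ne_zero hb hc) (fun k hk => by rw [Function.update_of_ne hk]; exact (W k).2)
    (by rw [Function.update_self]; exact hQi.mul (hφ.isUnit hd hb hP p)) (by
      apply localOp_mulVec_injective hQu
      rw [localOp_mulVec_mulVec, Matrix.mulVec_smul, hQ, smul_smul, div_mul_cancel₀ _ hc, ← hP]
      congr 2
      funext k
      by_cases hk : k = p
      · subst hk
        rw [Function.update_self, Matrix.mul_nonsing_inv_cancel_left _ _ hQp]
      · rw [Function.update_of_ne hk, hW k hk])
  refine ⟨a, ?_⟩
  rw [Function.update_self] at ha
  rw [← Matrix.mul_nonsing_inv_cancel_left _ (P p) hQp, ha, mul_smul_comm, mul_one]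

/-! ### Measurements with proportional outcomes -/

/-- If `Aᴴ * A` is scalar, `A` is a multiple of a unitary. The scalar `s` is automatically positive
for `d > 0`, as the diagonal entries of `Aᴴ * A` are nonnegative. -/
theorem exists_smul_unitary_of_conjTranspose_mul_self {d : ℕ} {A : Matrix (Fin d) (Fin d) ℂ}
    {s : ℂ} (hs : s • (Aᴴ * A) = 1) :
    ∃ (a : ℂ) (U : Matrix.unitaryGroup (Fin d) ℂ), A = a • (U : Matrix (Fin d) (Fin d) ℂ) := by
  rcases Nat.eq_zero_or_pos d with rfl | hd
  · exact ⟨1, 1, Subsingleton.elim _ _⟩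
  have h0 := congrFun (congrFun hs ⟨0, hd⟩) ⟨0, hd⟩
  obtain ⟨r, hr0, hr⟩ : ∃ r : ℝ, 0 ≤ r ∧ (Aᴴ * A) ⟨0, hd⟩ ⟨0, hd⟩ = r := by
    refine ⟨∑ i, ‖A i ⟨0, hd⟩‖ ^ 2, by positivity, ?_⟩
    simp [Matrix.mul_apply, Complex.conj_mul']
  rw [Matrix.smul_apply, hr, Matrix.one_apply_eq, smul_eq_mul] at h0
  have hrne : (r : ℂ) ≠ 0 := fun h => by simp [h] at h0
  have hrpos : 0 < r := lt_of_le_of_ne hr0 fun h => hrne (by simp [← h])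
  have hq : ((Real.sqrt r : ℝ) : ℂ) * (Real.sqrt r : ℝ) = r := by
    rw [← Complex.ofReal_mul, Real.mul_self_sqrt hr0]
  have hqne : ((Real.sqrt r : ℝ) : ℂ) ≠ 0 := fun h => hrne (by rw [← hq, h, mul_zero])
  refine ⟨(Real.sqrt r : ℝ), ⟨((Real.sqrt r : ℝ) : ℂ)⁻¹ • A, ?_⟩, ?_⟩
  · rw [Matrix.mem_unitaryGroup_iff', Matrix.star_eq_conjTranspose, Matrix.conjTranspose_smul,
      smul_mul_assoc, mul_smul_comm, smul_smul, ← hs]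
    congr 1
    simp only [star_inv₀, RCLike.star_def, Complex.conj_ofReal]
    rw [← mul_inv, hq]
    exact inv_eq_of_mul_eq_one_left h0
  · change A = (Real.sqrt r : ℂ) • ((Real.sqrt r : ℂ)⁻¹ • A)
    rw [smul_smul, mul_inv_cancel₀ hqne, one_smul]

/-- If all measurement operators are proportional up to unitaries, they are multiples of
unitaries. -/
theorem LOCCRound.kraus_eq_smul_unitary {n d : ℕ} (R : LOCCRound n d) (l : Fin R.outcomes)
    (h : ∀ k, ∃ x : ℂ, (R.kraus k)ᴴ * R.kraus k = x • ((R.kraus l)ᴴ * R.kraus l)) :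
    ∃ (a : ℂ) (U : Matrix.unitaryGroup (Fin d) ℂ),
      R.kraus l = a • (U : Matrix (Fin d) (Fin d) ℂ) := by
  choose x hx using h
  have hc := R.complete
  rw [Finset.sum_congr rfl fun k _ => hx k, ← Finset.sum_smul] at hc
  exact exists_smul_unitary_of_conjTranspose_mul_self hc

theorem LOCCRound.exists_kraus_ne_zero {n d : ℕ} (hd : 0 < d) (R : LOCCRound n d) :
    ∃ k, R.kraus k ≠ 0 := by
  by_contra! h
  have : Nonempty (Fin d) := ⟨⟨0, hd⟩⟩
  have hc := R.complete
  simp [h] at hc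

theorem LOCCRound.post_localOp {n d : ℕ} (R : LOCCRound n d) (k : Fin R.outcomes)
    (h : Fin n → Matrix (Fin d) (Fin d) ℂ) (φ : QState n d) :
    R.post k (localOp h *ᵥ φ) = localOp (fun j => Function.update
      (fun j => (R.corrections k j : Matrix (Fin d) (Fin d) ℂ)) R.party (R.kraus k) j * h j)
      *ᵥ φ := by
  rw [LOCCRound.post, localOp_mulVec_mulVec]

/-- A nonzero state has an outcome of nonzero probability. -/
theorem LOCCRound.exists_post_ne_zero {n d : ℕ} (R : LOCCRound n d) {χ : QState n d}
    (hχ : χ ≠ 0) : ∃ k, R.post k χ ≠ 0 := by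
  by_contra! h
  apply hχ
  have h1 : ∀ k, localOp (Function.update (fun _ => 1) R.party
      ((R.kraus k)ᴴ * R.kraus k)) *ᵥ χ = 0 := by
    intro k
    have : Function.update (fun _ => 1) R.party ((R.kraus k)ᴴ * R.kraus k) =
        fun j => Function.update (fun j => ((R.corrections k j : Matrix (Fin d) (Fin d) ℂ))ᴴ)
          R.party (R.kraus k)ᴴ j * Function.update
          (fun j => (R.corrections k j : Matrix (Fin d) (Fin d) ℂ)) R.party (R.kraus k) j := by
      funext j
      by_cases hj : j = R.party
      · subst hj; simp
      · simp only [Function.update_of_ne hj]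
        exact (Matrix.mem_unitaryGroup_iff'.1 (R.corrections k j).2).symm
    rw [this, ← localOp_mulVec_mulVec]
    have h2 := h k
    rw [LOCCRound.post] at h2
    rw [h2, Matrix.mulVec_zero]
  have h2 : ∑ k, localOp (Function.update (fun _ : Fin n => (1 : Matrix (Fin d) (Fin d) ℂ)) R.party
      ((R.kraus k)ᴴ * R.kraus k)) = 1 := by
    rw [← localOp_one]
    ext x y
    rw [Matrix.sum_apply]
    simp only [localOp, Matrix.of_apply]
    simp only [← Finset.mul_prod_erase _ _ (Finset.mem_univ R.party), Function.update_self]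
    rw [Finset.sum_congr rfl fun k _ => by
      rw [Finset.prod_congr rfl fun j hj => by
        rw [Function.update_of_ne (Finset.ne_of_mem_erase hj)]], ← Finset.sum_mul,
      ← Matrix.sum_apply, R.complete]
  rw [← Matrix.one_mulVec χ, ← h2, Matrix.sum_mulVec]
  exact Finset.sum_eq_zero fun k _ => h1 k

/-- A branch of nonzero probability realizes the transformation by a single local operator, which
may be singular. -/
theorem LOCCTransforms.exists_localOp {n d : ℕ} {φ : QState n d} : ∀ (N : ℕ) {χ : QState n d},
    χ ≠ 0 → LOCCTransforms N χ φ →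
    ∃ (M : Fin n → Matrix (Fin d) (Fin d) ℂ) (c : ℂ), c ≠ 0 ∧ localOp M *ᵥ χ = c • φ := by
  intro N
  induction N with
  | zero =>
    rintro χ hχ ⟨c, rfl⟩
    refine ⟨fun _ => 1, c, fun hc => hχ (by rw [hc, zero_smul]), ?_⟩
    rw [localOp_one, Matrix.one_mulVec]
  | succ N ih =>
    rintro χ hχ ⟨R, hR⟩
    obtain ⟨k, hk⟩ := R.exists_post_ne_zero hχ
    obtain ⟨M, c, hc, hM⟩ := ih hk (hR k)
    rw [LOCCRound.post, localOp_mulVec_mulVec] at hM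
    exact ⟨_, c, hc, hM⟩

/-! ### Rigid states are weakly isolated -/

theorem isUnit_of_mul_mul_isUnit {d : ℕ} {A B C : Matrix (Fin d) (Fin d) ℂ}
    (h : IsUnit (A * B * C)) : IsUnit B := by
  rw [Matrix.isUnit_iff_isUnit_det] at h ⊢
  rw [Matrix.det_mul, Matrix.det_mul] at h
  exact isUnit_of_mul_isUnit_right (isUnit_of_mul_isUnit_left h)

theorem isUnit_coe_unitary {d : ℕ} (U : Matrix.unitaryGroup (Fin d) ℂ) :
    IsUnit (U : Matrix (Fin d) (Fin d) ℂ) :=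
  ⟨Unitary.toUnits U, rfl⟩

theorem conjTranspose_mul_self_smul_unitary_mul {d : ℕ} (a : ℂ)
    (U : Matrix.unitaryGroup (Fin d) ℂ) (A : Matrix (Fin d) (Fin d) ℂ) :
    (a • ((U : Matrix (Fin d) (Fin d) ℂ) * A))ᴴ * (a • ((U : Matrix (Fin d) (Fin d) ℂ) * A)) =
      (star a * a) • (Aᴴ * A) := by
  have := Matrix.mem_unitaryGroup_iff'.1 U.2
  rw [Matrix.star_eq_conjTranspose] at this
  rw [Matrix.conjTranspose_smul, smul_mul_assoc, mul_smul_comm, smul_smul,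
    Matrix.conjTranspose_mul, Matrix.mul_assoc, ← Matrix.mul_assoc _ _ A, this, Matrix.one_mul]

theorem LOCCRound.post_eq_smul_of_kraus_eq {n d : ℕ} (R : LOCCRound n d) (l : Fin R.outcomes)
    {a : ℂ} {U : Matrix.unitaryGroup (Fin d) ℂ}
    (h : R.kraus l = a • (U : Matrix (Fin d) (Fin d) ℂ)) (χ : QState n d) :
    R.post l χ = a • (localOp (fun j => ((Function.update (R.corrections l) R.party U j :
      Matrix.unitaryGroup (Fin d) ℂ) : Matrix (Fin d) (Fin d) ℂ)) *ᵥ χ) := by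
  have : Function.update (fun j => (R.corrections l j : Matrix (Fin d) (Fin d) ℂ)) R.party
      (R.kraus l) = fun j => (Function.update (fun _ => (1 : ℂ)) R.party a j) •
        ((Function.update (R.corrections l) R.party U j :
      Matrix.unitaryGroup (Fin d) ℂ) : Matrix (Fin d) (Fin d) ℂ) := by
    funext j
    by_cases hj : j = R.party
    · subst hj; simp [h]
    · simp [hj]
  rw [LOCCRound.post, this, localOp_smul, Finset.prod_update_of_mem (Finset.mem_univ _),
    Matrix.smul_mulVec]
  simp

/-- Rigid states are not reachable. The induction on the number of rounds shows that each outcome of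
the first round is already LU-equivalent to `φ`, so that the first round is a local unitary. -/
theorem IsRigid.luEquivalent_of_transforms {n d : ℕ} (hd : 2 ≤ d) {φ : QState n d}
    (hφ : IsRigid φ) : ∀ (N : ℕ) (h : Fin n → Matrix (Fin d) (Fin d) ℂ), (∀ k, IsUnit (h k)) →
      n ≠ 0 → LOCCTransforms N (localOp h *ᵥ φ) φ → LUEquivalent (localOp h *ᵥ φ) φ := by
  intro N
  have : Nonempty (Fin d) := ⟨⟨0, by omega⟩⟩
  induction N with
  | zero =>
    rintro h hh hn ⟨c, hc⟩
    refine ⟨1, c, ?_, by simp only [Pi.one_apply, OneMemClass.coe_one, localOp_one,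
      Matrix.one_mulVec, hc]⟩
    rintro rfl
    rw [zero_smul] at hc
    exact hφ.mulVec_ne_zero hd ⟨0, Nat.pos_of_ne_zero hn⟩ (fun k _ => hh k) (hh _).ne_zero hc
  | succ N ih =>
    rintro h hh hn ⟨R, hR⟩
    set p := R.party with hp
    -- the local operator applied by the outcome `k`
    set K : Fin R.outcomes → Fin n → Matrix (Fin d) (Fin d) ℂ := fun k => Function.update
      (fun j => (R.corrections k j : Matrix (Fin d) (Fin d) ℂ)) p (R.kraus k) with hK
    have hKp : ∀ k, K k p = R.kraus k := fun k => by simp [hK]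
    have hKj : ∀ k, ∀ j ≠ p, K k j = R.corrections k j := fun k j hj => by simp [hK, hj]
    have hpost : ∀ k, R.post k (localOp h *ᵥ φ) = localOp (fun j => K k j * h j) *ᵥ φ :=
      fun k => R.post_localOp k h φ
    have hbranch : ∀ k, R.kraus k ≠ 0 → ∃ (V : Fin n → Matrix.unitaryGroup (Fin d) ℂ) (c : ℂ),
        c ≠ 0 ∧ localOp (fun j => (V j : Matrix (Fin d) (Fin d) ℂ) * (K k j * h j)) *ᵥ φ
          = c • φ := by
      intro k hk
      have hKu : ∀ j ≠ p, IsUnit (K k j * h j) := fun j hj => by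
        rw [hKj k j hj]
        exact (isUnit_coe_unitary _).mul (hh j)
      have hne : localOp (fun j => K k j * h j) *ᵥ φ ≠ 0 := by
        refine hφ.mulVec_ne_zero hd p hKu fun h0 => hk ?_
        rw [hKp] at h0
        exact (hh p).mul_left_eq_zero.1 h0
      have hRk := hR k
      rw [hpost] at hRk
      obtain ⟨M, c, hc, hM⟩ := LOCCTransforms.exists_localOp N hne hRk
      rw [localOp_mulVec_mulVec] at hM
      have hu := hφ.isUnit hd hc hM p
      rw [hKp, ← Matrix.mul_assoc] at hu
      have hku := isUnit_of_mul_mul_isUnit hu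
      obtain ⟨V, c, hc, hV⟩ := ih (fun j => K k j * h j) (fun j => by
        by_cases hj : j = p
        · subst hj
          rw [hKp]
          exact hku.mul (hh _)
        · exact hKu j hj) hn hRk
      exact ⟨V, c, hc, by rw [← localOp_mulVec_mulVec]; exact hV⟩
    obtain ⟨l, hl⟩ := R.exists_kraus_ne_zero (by omega)
    obtain ⟨V, c, hc, hV⟩ := hbranch l hl
    obtain ⟨a, U, hU⟩ := R.kraus_eq_smul_unitary l (by
      intro k
      by_cases hk : R.kraus k = 0
      · exact ⟨0, by simp [hk]⟩
      obtain ⟨V', c', hc', hV'⟩ := hbranch k hk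
      obtain ⟨a, ha⟩ := hφ.exists_smul_of_left hd hc' hc hV' hV p
        (fun j => V' j * R.corrections k j * (V j * R.corrections l j)⁻¹) (by
          intro j hj
          rw [hKj k j hj, hKj l j hj]
          simp only [← Matrix.mul_assoc, ← Submonoid.coe_mul]
          rw [inv_mul_cancel_right])
      rw [hKp, hKp, ← Matrix.mul_assoc, ← Matrix.mul_assoc, ← smul_mul_assoc] at ha
      have ha := (hh p).mul_right_cancel ha
      refine ⟨star a * a, ?_⟩
      rw [← conjTranspose_mul_self_smul_unitary_mul a (V p), ← ha]
      simpa using (conjTranspose_mul_self_smul_unitary_mul 1 (V' p) (R.kraus k)).symm)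
    have ha : a ≠ 0 := by
      rintro rfl
      exact hl (by rw [hU, zero_smul])
    refine ⟨fun j => V j * Function.update (R.corrections l) p U j, a⁻¹ * c,
      mul_ne_zero (inv_ne_zero ha) hc, ?_⟩
    have h1 := R.post_eq_smul_of_kraus_eq l hU (localOp h *ᵥ φ)
    rw [hpost] at h1
    rw [← localOp_mulVec_mulVec, h1, Matrix.mulVec_smul] at hV
    simp only [Submonoid.coe_mul]
    rw [← localOp_mulVec_mulVec, mul_smul, ← hV, smul_smul, inv_mul_cancel₀ ha, one_smul]

/-- Rigid states are not convertible: the outcomes of a round on `φ` that all lead to `h φ` give,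
after applying the inverse of `h`, local symmetries of `φ` that differ by unitaries on the right. -/
theorem IsRigid.luEquivalent_of_oneRound {n d : ℕ} (hd : 2 ≤ d) {φ : QState n d}
    (hφ : IsRigid φ) (h : Fin n → Matrix (Fin d) (Fin d) ℂ) (hh : ∀ k, IsUnit (h k))
    (ht : LOCCTransforms 1 φ (localOp h *ᵥ φ)) : LUEquivalent φ (localOp h *ᵥ φ) := by
  have : Nonempty (Fin d) := ⟨⟨0, by omega⟩⟩
  obtain ⟨R, hR⟩ := ht
  set p := R.party with hp
  set K : Fin R.outcomes → Fin n → Matrix (Fin d) (Fin d) ℂ := fun k => Function.update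
    (fun j => (R.corrections k j : Matrix (Fin d) (Fin d) ℂ)) p (R.kraus k) with hK
  have hKp : ∀ k, K k p = R.kraus k := fun k => by simp [hK]
  have hKj : ∀ k, ∀ j ≠ p, K k j = R.corrections k j := fun k j hj => by simp [hK, hj]
  have hbranch : ∀ k, R.kraus k ≠ 0 → ∃ c : ℂ, c ≠ 0 ∧
      localOp (K k) *ᵥ φ = c • (localOp h *ᵥ φ) := by
    intro k hk
    obtain ⟨c, hc⟩ := hR k
    refine ⟨c, ?_, hc⟩
    rintro rfl
    rw [zero_smul] at hc
    refine hφ.mulVec_ne_zero hd p (fun j hj => ?_) ?_ hc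
    · rw [Function.update_of_ne hj]
      exact isUnit_coe_unitary _
    · rwa [Function.update_self]
  have hpull : ∀ k (c : ℂ), localOp (K k) *ᵥ φ = c • (localOp h *ᵥ φ) →
      localOp (fun j => (h j)⁻¹ * K k j) *ᵥ φ = c • φ := by
    intro k c hc
    rw [← localOp_mulVec_mulVec, hc, Matrix.mulVec_smul, localOp_inv_mulVec hh]
  obtain ⟨l, hl⟩ := R.exists_kraus_ne_zero (by omega)
  obtain ⟨c, hc, hlc⟩ := hbranch l hl
  obtain ⟨a, U, hU⟩ := R.kraus_eq_smul_unitary l (by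
    intro k
    by_cases hk : R.kraus k = 0
    · exact ⟨0, by simp [hk]⟩
    obtain ⟨c', hc', hkc⟩ := hbranch k hk
    obtain ⟨a, ha⟩ := hφ.exists_smul_of_right hd hc' hc (hpull k c' hkc) (hpull l c hlc) p
      (fun j => (R.corrections l j)⁻¹ * R.corrections k j) (by
        intro j hj
        rw [hKj k j hj, hKj l j hj, Matrix.mul_assoc, ← Submonoid.coe_mul, mul_inv_cancel_left])
    rw [hKp, hKp, ← mul_smul_comm] at ha
    have ha := ((Matrix.isUnit_nonsing_inv_iff).2 (hh p)).mul_left_cancel ha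
    refine ⟨star a * a, ?_⟩
    rw [ha, Matrix.conjTranspose_smul, smul_mul_assoc, mul_smul_comm, smul_smul])
  have ha : a ≠ 0 := by
    rintro rfl
    exact hl (by rw [hU, zero_smul])
  refine ⟨Function.update (R.corrections l) p U, a⁻¹ * c, mul_ne_zero (inv_ne_zero ha) hc, ?_⟩
  rw [mul_smul, ← hlc]
  change _ = a⁻¹ • R.post l φ
  rw [R.post_eq_smul_of_kraus_eq l hU, smul_smul, inv_mul_cancel₀ ha, one_smul]

theorem IsRigid.isWeaklyIsolated {n d : ℕ} (hn : n ≠ 0) (hd : 2 ≤ d) {φ : QState n d}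
    (hφ : IsRigid φ) : IsWeaklyIsolated φ := by
  refine ⟨?_, ?_⟩
  · rintro ⟨ψ, ⟨g, rfl⟩, hLU, N, hN⟩
    exact hLU (hφ.luEquivalent_of_transforms hd N _ (fun k => (g k).isUnit) hn hN)
  · rintro ⟨χ, ⟨g, rfl⟩, hLU, h⟩
    exact hLU (hφ.luEquivalent_of_oneRound hd _ (fun k => (g k).isUnit) h)

/-! ### Construction of a rigid state -/

section

open scoped ComplexOrder MatrixOrder Matrix.Norms.L2Operator

/-- A matrix proportional to a unitary that commutes with a diagonal matrix with distinct entries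
and with the all-ones matrix is scalar. -/
theorem exists_eq_smul_one_of_fixes {d : ℕ} (hd : 0 < d) {S : Matrix (Fin d) (Fin d) ℂ} {r : ℂ}
    {D : Fin d → ℂ} (hD : Function.Injective D)
    (h1 : r • (Sᴴ * 1 * S) = 1)
    (h2 : r • (Sᴴ * Matrix.diagonal D * S) = Matrix.diagonal D)
    (h3 : r • (Sᴴ * Matrix.of (fun _ _ => 1) * S) = Matrix.of (fun _ _ => 1)) :
    ∃ a : ℂ, S = a • 1 := by
  have hinv : S * (r • Sᴴ) = 1 := by
    rw [mul_eq_one_comm, smul_mul_assoc, ← h1, Matrix.mul_one]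
  have hcomm : ∀ X, r • (Sᴴ * X * S) = X → S * X = X * S := by
    intro X hX
    conv_lhs => rw [← hX]
    rw [mul_smul_comm, ← mul_assoc, ← mul_assoc, ← smul_mul_assoc, ← smul_mul_assoc,
      ← mul_smul_comm, hinv, one_mul]
  have hoff : ∀ i j, i ≠ j → S i j = 0 := by
    intro i j hij
    have := congrFun (congrFun (hcomm _ h2) i) j
    rw [Matrix.mul_diagonal, Matrix.diagonal_mul] at this
    have h4 : (D j - D i) * S i j = 0 := by linear_combination this
    exact (mul_eq_zero.1 h4).resolve_left (sub_ne_zero.2 fun h => hij (hD h).symm)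
  have hdiag : ∀ i j, S i i = S j j := by
    intro i j
    have := congrFun (congrFun (hcomm _ h3) i) j
    simp only [Matrix.mul_apply, Matrix.of_apply, mul_one, one_mul] at this
    rwa [Finset.sum_eq_single i (fun k _ hk => hoff i k hk.symm) (by simp),
      Finset.sum_eq_single j (fun k _ hk => hoff k j hk) (by simp)] at this
  refine ⟨S ⟨0, hd⟩ ⟨0, hd⟩, ?_⟩
  ext i j
  by_cases hij : i = j
  · subst hij; simp [hdiag i ⟨0, hd⟩]
  · simp [hij, hoff i j hij]

theorem exists_gl_conjTranspose_mul_self {d : ℕ} {G : Matrix (Fin d) (Fin d) ℂ} (hG : G.PosDef) :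
    ∃ g : GL (Fin d) ℂ, (g : Matrix (Fin d) (Fin d) ℂ)ᴴ * (g : Matrix (Fin d) (Fin d) ℂ) = G := by
  obtain ⟨B, hB⟩ := CStarAlgebra.nonneg_iff_eq_star_mul_self.1 hG.posSemidef.nonneg
  rw [Matrix.star_eq_conjTranspose] at hB
  have hu := hG.isUnit
  rw [hB, Matrix.isUnit_iff_isUnit_det, Matrix.det_mul] at hu
  have hBu : IsUnit B := (Matrix.isUnit_iff_isUnit_det _).2 (isUnit_of_mul_isUnit_right hu)
  exact ⟨hBu.unit, hB.symm⟩

/-- Positive definite matrices any `n - 1` of which are preserved, up to a common factor, only by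
scalar congruences. -/
theorem exists_posDef_family {n d : ℕ} (hn : 4 ≤ n) (hd : 0 < d) :
    ∃ G : Fin n → Matrix (Fin d) (Fin d) ℂ, (∀ k, (G k).PosDef) ∧
      ∀ (S : Matrix (Fin d) (Fin d) ℂ) (p : Fin n) (r : ℂ),
        (∀ k ≠ p, r • (Sᴴ * G k * S) = G k) → ∃ a : ℂ, S = a • 1 := by
  set D : Fin d → ℂ := fun j => (j : ℂ) + 1 with hD
  have hDinj : Function.Injective D := by
    intro i j h
    simpa [hD, Fin.ext_iff] using h
  set J : Matrix (Fin d) (Fin d) ℂ := Matrix.of fun _ _ => 1 with hJ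
  have hDpos : (Matrix.diagonal D).PosDef := by
    rw [Matrix.posDef_diagonal_iff]
    intro j
    have : D j = (((j : ℕ) + 1 : ℝ) : ℂ) := by simp [hD]
    rw [this]
    exact_mod_cast Nat.succ_pos _
  have hJpos : J.PosSemidef := by
    have : J = Matrix.vecMulVec (fun _ => 1) (star fun _ => 1) := by
      ext; simp [hJ, Matrix.vecMulVec_apply]
    rw [this]
    exact Matrix.posSemidef_vecMulVec_self_star _
  have h1pos : (1 : Matrix (Fin d) (Fin d) ℂ).PosDef := Matrix.PosDef.one
  have h1J : (1 + J).PosDef := h1pos.add_posSemidef hJpos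
  set G : Fin n → Matrix (Fin d) (Fin d) ℂ := fun k =>
    if k.val = 1 then Matrix.diagonal D else if k.val = 2 then 1 + J else
      if k.val = 3 then 1 + Matrix.diagonal D + (1 + J) else 1 with hGdef
  refine ⟨G, ?_, ?_⟩
  · intro k
    simp only [hGdef]
    split_ifs
    · exact hDpos
    · exact h1J
    · exact (h1pos.add hDpos).add h1J
    · exact h1pos
  · intro S p r h
    have hadd : ∀ X Y, r • (Sᴴ * X * S) = X → r • (Sᴴ * Y * S) = Y →
        r • (Sᴴ * (X + Y) * S) = X + Y := by
      intro X Y hX hY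
      rw [Matrix.mul_add, Matrix.add_mul, smul_add, hX, hY]
    have hsub : ∀ X Y, r • (Sᴴ * (X + Y) * S) = X + Y → r • (Sᴴ * Y * S) = Y →
        r • (Sᴴ * X * S) = X := by
      intro X Y hXY hY
      rw [Matrix.mul_add, Matrix.add_mul, smul_add, hY] at hXY
      exact add_right_cancel hXY
    have e0 : p.val ≠ 0 → r • (Sᴴ * 1 * S) = 1 := fun hp => by
      simpa [hGdef] using h ⟨0, by omega⟩ (by rw [ne_eq, Fin.ext_iff]; exact fun h => hp h.symm)
    have e1 : p.val ≠ 1 → r • (Sᴴ * Matrix.diagonal D * S) = Matrix.diagonal D := fun hp => by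
      simpa [hGdef] using h ⟨1, by omega⟩ (by rw [ne_eq, Fin.ext_iff]; exact fun h => hp h.symm)
    have e2 : p.val ≠ 2 → r • (Sᴴ * (1 + J) * S) = 1 + J := fun hp => by
      simpa [hGdef] using h ⟨2, by omega⟩ (by rw [ne_eq, Fin.ext_iff]; exact fun h => hp h.symm)
    have e3 : p.val ≠ 3 → r • (Sᴴ * (1 + Matrix.diagonal D + (1 + J)) * S) =
        1 + Matrix.diagonal D + (1 + J) := fun hp => by
      simpa [hGdef] using h ⟨3, by omega⟩ (by rw [ne_eq, Fin.ext_iff]; exact fun h => hp h.symm)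
    have f0 : r • (Sᴴ * 1 * S) = 1 := by
      by_cases hp : p.val = 0
      · exact hsub _ _ (hsub _ _ (e3 (by omega)) (e2 (by omega))) (e1 (by omega))
      · exact e0 hp
    have f1 : r • (Sᴴ * Matrix.diagonal D * S) = Matrix.diagonal D := by
      by_cases hp : p.val = 1
      · refine hsub _ 1 ?_ f0
        rw [add_comm]
        exact hsub _ _ (e3 (by omega)) (e2 (by omega))
      · exact e1 hp
    have f2 : r • (Sᴴ * (1 + J) * S) = 1 + J := by
      by_cases hp : p.val = 2
      · refine hsub _ (1 + Matrix.diagonal D) ?_ (hadd _ _ f0 f1)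
        rw [add_comm]
        exact e3 (by omega)
      · exact e2 hp
    refine exists_eq_smul_one_of_fixes hd hDinj f0 f1 (hsub _ 1 ?_ f0)
    rw [add_comm]
    exact f2

/-- If all symmetries of `ψ` are tensor powers, then so are, factor by factor and up to scalars, the
local operators that fix `ψ` up to a nonzero scalar. -/
theorem exists_factors_of_mulVec_eq_smul {n d : ℕ} (hn : n ≠ 0) (hd : 0 < d) {ψ : QState n d}
    (hψ : symmetryGroup ψ ⊆ tensorPowers n d) {T : Fin n → Matrix (Fin d) (Fin d) ℂ}
    (hT : ∀ k, IsUnit (T k)) {c : ℂ} (hc : c ≠ 0) (h : localOp T *ᵥ ψ = c • ψ) :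
    ∃ (S : GL (Fin d) ℂ) (b : Fin n → ℂ),
      ∀ k, b k ≠ 0 ∧ T k = b k • (S : Matrix (Fin d) (Fin d) ℂ) := by
  obtain ⟨m, rfl⟩ := Nat.exists_eq_succ_of_ne_zero hn
  -- `c` is absorbed into the factor of the party `0` to obtain a genuine symmetry
  set e : Fin (m + 1) → ℂ := Function.update (fun _ => 1) 0 c⁻¹ with he
  have hene : ∀ k, e k ≠ 0 := by
    intro k
    by_cases hk : k = 0
    · subst hk; simpa [he] using hc
    · simp [he, hk]
  have heprod : ∏ k, e k = c⁻¹ := by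
    rw [he, Finset.prod_update_of_mem (Finset.mem_univ _)]; simp
  have hTe : ∀ k, IsUnit (e k • T k) := fun k => (hT k).smul (Units.mk0 (e k) (hene k))
  obtain ⟨S, hS⟩ := hψ (a := localOp fun k => e k • T k) ⟨⟨fun k => (hTe k).unit, rfl⟩, by
    rw [localOp_smul, heprod, Matrix.smul_mulVec, h, smul_smul, inv_mul_cancel₀ hc, one_smul]⟩
  choose a ha hab using fun k => exists_smul_of_localOp_eq hd hTe hS k
  refine ⟨S, fun k => (e k)⁻¹ * a k, fun k => ⟨mul_ne_zero (inv_ne_zero (hene k)) (ha k), ?_⟩⟩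
  rw [mul_smul, ← hab k, smul_smul, inv_mul_cancel₀ (hene k), one_smul]

/-- The SLOCC class of a state whose symmetries are tensor powers contains a rigid state. -/
theorem exists_isRigid_mem_sloccClass {n d : ℕ} (hn : 4 ≤ n) (hd : 0 < d) {ψ : QState n d}
    (hψ : symmetryGroup ψ ⊆ tensorPowers n d) : ∃ φ ∈ sloccClass ψ, IsRigid φ := by
  obtain ⟨G, hG, hGS⟩ := exists_posDef_family (n := n) hn hd
  choose g hg using fun k => exists_gl_conjTranspose_mul_self (hG k)
  refine ⟨_, ⟨g, rfl⟩, ?_⟩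
  intro T p c hc hTu hTp hT
  have hgu : ∀ k, IsUnit (g k : Matrix (Fin d) (Fin d) ℂ) := fun k => (g k).isUnit
  have hTk : ∀ k, IsUnit (T k) := by
    intro k
    by_cases hk : k = p
    · subst hk; exact hTp
    · exact isUnit_coe_unitary ⟨T k, hTu k hk⟩
  obtain ⟨S, b, hb⟩ := exists_factors_of_mulVec_eq_smul (by omega) hd hψ
    (T := fun k => (g k : Matrix (Fin d) (Fin d) ℂ)⁻¹ * (T k * (g k : Matrix (Fin d) (Fin d) ℂ)))
    (fun k => (Matrix.isUnit_nonsing_inv_iff.2 (hgu k)).mul ((hTk k).mul (hgu k))) hc (by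
      rw [← localOp_mulVec_mulVec, ← localOp_mulVec_mulVec, hT, Matrix.mulVec_smul,
        localOp_inv_mulVec hgu])
  have hTg : ∀ k, T k * (g k : Matrix (Fin d) (Fin d) ℂ) = b k • ((g k : Matrix (Fin d) (Fin d) ℂ) * S) := by
    intro k
    have := congrArg (fun X => (g k : Matrix (Fin d) (Fin d) ℂ) * X) (hb k).2
    rwa [Matrix.mul_nonsing_inv_cancel_left _ _ ((Matrix.isUnit_iff_isUnit_det _).1 (hgu k)),
      mul_smul_comm] at this
  -- unitarity of `T k` says that `S` preserves `G k` up to the factor `‖b k‖²`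
  have hpres : ∀ k ≠ p, ((‖b k‖ ^ 2 : ℝ) : ℂ) •
      ((S : Matrix (Fin d) (Fin d) ℂ)ᴴ * G k * S) = G k := by
    intro k hk
    have h1 : (T k * (g k : Matrix (Fin d) (Fin d) ℂ))ᴴ * (T k * (g k : Matrix (Fin d) (Fin d) ℂ)) = G k := by
      have := conjTranspose_mul_self_smul_unitary_mul 1 ⟨T k, hTu k hk⟩
        (g k : Matrix (Fin d) (Fin d) ℂ)
      simpa [hg] using this
    rw [hTg] at h1
    conv_rhs => rw [← h1, Matrix.conjTranspose_smul, smul_mul_assoc, mul_smul_comm, smul_smul,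
      Matrix.conjTranspose_mul]
    rw [← hg k]
    congr 1
    · simp [Complex.conj_mul']
    · simp only [Matrix.mul_assoc]
  -- comparing determinants, these factors are all equal
  have hnorm : ∀ k ≠ p, (‖b k‖ ^ 2) ^ d * ‖(S : Matrix (Fin d) (Fin d) ℂ).det‖ ^ 2 = 1 := by
    intro k hk
    have h1 := congrArg (fun X => ‖Matrix.det X‖) (hpres k hk)
    have h2 : ‖(G k).det‖ ≠ 0 := by
      rw [norm_ne_zero_iff]
      exact (hG k).det_pos.ne'
    simp only [Matrix.det_smul, Matrix.det_mul, Matrix.det_conjTranspose, norm_mul, norm_pow,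
      norm_star, Fintype.card_fin, Complex.norm_real, norm_norm] at h1
    apply mul_right_cancel₀ h2
    rw [one_mul]
    nth_rewrite 2 [← h1]
    ring
  have hSdet : ‖(S : Matrix (Fin d) (Fin d) ℂ).det‖ ^ 2 ≠ 0 := by
    have := ((Matrix.isUnit_iff_isUnit_det _).1 S.isUnit).ne_zero
    positivity
  have : Nontrivial (Fin n) := Fin.nontrivial_iff_two_le.2 (by omega)
  obtain ⟨q, hq⟩ := exists_ne p
  obtain ⟨a, ha⟩ := hGS S p ((‖b q‖ ^ 2 : ℝ) : ℂ) (by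
    intro k hk
    have h1 : (‖b k‖ ^ 2) ^ d = (‖b q‖ ^ 2) ^ d :=
      mul_right_cancel₀ hSdet ((hnorm k hk).trans (hnorm q hq).symm)
    rw [← (pow_left_inj₀ (by positivity) (by positivity) hd.ne').1 h1]
    exact hpres k hk)
  refine ⟨b p * a, ?_⟩
  have := hTg p
  rw [ha, mul_smul_comm, mul_one, smul_smul] at this
  exact (hgu p).mul_right_cancel (by rw [this, smul_mul_assoc, one_mul])

end

/-! ### The totally antisymmetric state -/

theorem antisymmetricState_perm {n : ℕ} (π : Equiv.Perm (Fin n)) :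
    antisymmetricState n π = ((1 / Real.sqrt (n.factorial : ℝ) : ℝ) : ℂ) *
      (((Equiv.Perm.sign π : ℤˣ) : ℤ) : ℂ) := by
  rw [antisymmetricState, Pi.smul_apply, Finset.sum_apply, smul_eq_mul]
  congr 1
  rw [Finset.sum_eq_single π]
  · simp
  · intro σ _ hσ
    simp [DFunLike.coe_fn_eq, hσ.symm]
  · simp

theorem antisymmetricState_perm_ne_zero {n : ℕ} (π : Equiv.Perm (Fin n)) :
    antisymmetricState n π ≠ 0 := by
  rw [antisymmetricState_perm]
  apply mul_ne_zero
  · have : (0 : ℝ) < n.factorial := by exact_mod_cast n.factorial_pos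
    exact_mod_cast (by positivity : (1 / Real.sqrt (n.factorial : ℝ) : ℝ) ≠ 0)
  · exact_mod_cast (Equiv.Perm.sign π).ne_zero

theorem antisymmetricState_of_not_injective {n : ℕ} {x : Fin n → Fin n}
    (hx : ¬ Function.Injective x) : antisymmetricState n x = 0 := by
  rw [antisymmetricState, Pi.smul_apply, Finset.sum_apply, Finset.sum_eq_zero, smul_zero]
  intro σ _
  have : x ≠ σ := fun h => hx (h ▸ σ.injective)
  simp [this]

theorem antisymmetricState_comp_swap {n : ℕ} {i j : Fin n} (hij : i ≠ j) (x : Fin n → Fin n) :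
    antisymmetricState n (x ∘ Equiv.swap i j) = - antisymmetricState n x := by
  by_cases hx : Function.Injective x
  · obtain ⟨π, rfl⟩ : ∃ π : Equiv.Perm (Fin n), x = π :=
      ⟨Equiv.ofBijective x (Finite.injective_iff_bijective.1 hx), rfl⟩
    rw [← Equiv.Perm.coe_mul, antisymmetricState_perm, antisymmetricState_perm,
      Equiv.Perm.sign_mul, Equiv.Perm.sign_swap hij]
    simp
  · rw [antisymmetricState_of_not_injective hx, antisymmetricState_of_not_injective, neg_zero]
    intro h
    exact hx ((Equiv.swap i j).injective_comp x |>.1 h)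

/-- Exchanging two tensor factors of a symmetry of the antisymmetric state gives a symmetry. -/
theorem localOp_comp_swap_mulVec_antisymmetricState {n : ℕ} {i j : Fin n} (hij : i ≠ j)
    {S : Fin n → Matrix (Fin n) (Fin n) ℂ}
    (h : localOp S *ᵥ antisymmetricState n = antisymmetricState n) :
    localOp (fun k => S (Equiv.swap i j k)) *ᵥ antisymmetricState n = antisymmetricState n := by
  funext x
  have h1 := congrFun h (x ∘ Equiv.swap i j)
  rw [antisymmetricState_comp_swap hij] at h1
  rw [← neg_inj, ← h1]
  simp only [Matrix.mulVec, dotProduct]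
  rw [← Finset.sum_neg_distrib,
    ← Equiv.sum_comp (Equiv.arrowCongr (Equiv.swap i j) (Equiv.refl (Fin n)))]
  refine Finset.sum_congr rfl fun y _ => ?_
  have hy : (Equiv.arrowCongr (Equiv.swap i j) (Equiv.refl (Fin n))) y = y ∘ Equiv.swap i j := by
    funext k; simp [Equiv.arrowCongr]
  rw [hy, antisymmetricState_comp_swap hij, mul_neg, neg_neg]
  congr 1
  simp only [localOp, Matrix.of_apply, Function.comp]
  rw [← Equiv.prod_comp (Equiv.swap i j)]
  simp

theorem localOp_update_mulVec {n d : ℕ} (p : Fin n) (M : Matrix (Fin d) (Fin d) ℂ)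
    (φ : QState n d) (x : Fin n → Fin d) :
    (localOp (Function.update (fun _ => 1) p M) *ᵥ φ) x =
      ∑ z, M (x p) z * φ (Function.update x p z) := by
  have hloc : ∀ y, localOp (Function.update (fun _ => 1) p M) x y =
      if y = Function.update x p (y p) then M (x p) (y p) else 0 := by
    intro y
    simp only [localOp, Matrix.of_apply]
    rw [← Finset.mul_prod_erase _ _ (Finset.mem_univ p), Function.update_self]
    split_ifs with hy
    · rw [Finset.prod_eq_one, mul_one]
      intro k hk
      have hk := Finset.ne_of_mem_erase hk
      have : y k = x k := by rw [hy, Function.update_of_ne hk]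
      rw [Function.update_of_ne hk, this, Matrix.one_apply_eq]
    · obtain ⟨k, hk⟩ : ∃ k, y k ≠ Function.update x p (y p) k := by
        by_contra! hcon
        exact hy (funext hcon)
      have hkp : k ≠ p := by
        rintro rfl
        simp at hk
      rw [Function.update_of_ne hkp] at hk
      rw [Finset.prod_eq_zero (Finset.mem_erase.2 ⟨hkp, Finset.mem_univ k⟩), mul_zero]
      rw [Function.update_of_ne hkp, Matrix.one_apply_ne hk.symm]
  simp only [Matrix.mulVec, dotProduct, hloc]
  symm
  refine Finset.sum_of_injOn (fun z => Function.update x p z) ?_ ?_ ?_ ?_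
  · intro a _ b _ hab
    exact Function.update_injective x p hab
  · intro _ _; simp
  · intro y _ hy
    rw [if_neg, zero_mul]
    intro h
    exact hy ⟨y p, by simp, h.symm⟩
  · intro z _
    simp

theorem exists_perm_apply_eq_apply_eq {α : Type*} [DecidableEq α] {i j b c : α} (hij : i ≠ j)
    (hbc : b ≠ c) : ∃ σ : Equiv.Perm α, σ i = b ∧ σ j = c := by
  refine ⟨Equiv.swap (Equiv.swap i b j) c * Equiv.swap i b, ?_, by simp⟩
  rw [Equiv.Perm.mul_apply, Equiv.swap_apply_left, Equiv.swap_apply_of_ne_of_ne _ hbc]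
  intro h
  have h : Equiv.swap i b i = Equiv.swap i b j := by rwa [Equiv.swap_apply_left]
  exact hij ((Equiv.swap i b).injective h)

/-- An operator that acts on the antisymmetric state in the same way at two different parties is
scalar. -/
theorem exists_eq_smul_one_of_antisymmetricState {n : ℕ} (hn : 3 ≤ n) {i j : Fin n} (hij : i ≠ j)
    {M : Matrix (Fin n) (Fin n) ℂ}
    (h : localOp (Function.update (fun _ => 1) i M) *ᵥ antisymmetricState n =
      localOp (Function.update (fun _ => 1) j M) *ᵥ antisymmetricState n) :
    ∃ a : ℂ, M = a • 1 := by
  have hzero : ∀ (σ : Equiv.Perm (Fin n)) (p z : Fin n), z ≠ σ p →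
      antisymmetricState n (Function.update σ p z) = 0 := by
    intro σ p z hz
    apply antisymmetricState_of_not_injective
    intro hinj
    have hne : σ.symm z ≠ p := fun h => hz (by rw [← h, Equiv.apply_symm_apply])
    exact hne (hinj (by simp [hne]))
  have hoff : ∀ a b, a ≠ b → M a b = 0 := by
    intro a b hab
    obtain ⟨c, hc⟩ : ∃ c, c ∉ ({a, b} : Finset (Fin n)) := by
      by_contra! hcon
      have h1 := Finset.card_le_card (fun x _ => hcon x : Finset.univ ⊆ {a, b})
      have h2 := Finset.card_le_two (a := a) (b := b)
      rw [Finset.card_univ, Fintype.card_fin] at h1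
      omega
    simp only [Finset.mem_insert, Finset.mem_singleton, not_or] at hc
    obtain ⟨σ, hσi, hσj⟩ := exists_perm_apply_eq_apply_eq hij (Ne.symm hc.2)
    -- the entry `M a b` is the coefficient of both sides at `σ` with the label `b` at `i` replaced
    -- by `a`; the label `c ≠ a` at `j` makes the right-hand side vanish
    have h1 := congrFun h (Function.update σ i a)
    rw [localOp_update_mulVec, localOp_update_mulVec, Finset.sum_eq_single b, Finset.sum_eq_zero]
      at h1
    · rw [Function.update_self, Function.update_idem, ← hσi, Function.update_eq_self] at h1
      rw [← hσi]
      exact (mul_eq_zero.1 h1).resolve_right (antisymmetricState_perm_ne_zero σ)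
    · intro z _
      rw [antisymmetricState_of_not_injective, mul_zero]
      -- the label `a` occurs both at `i` and at `σ⁻¹ a`
      intro hinj
      have hi : σ.symm a ≠ i := fun h => hab (by rw [← hσi, ← h, Equiv.apply_symm_apply])
      have hj : σ.symm a ≠ j := fun h => hc.1 (by rw [← hσj, ← h, Equiv.apply_symm_apply])
      exact hi (hinj (by simp [hi, hj, hij]))
    · intro z _ hz
      rw [Function.update_idem, hzero σ i z (by rwa [hσi]), mul_zero]
    · simp
  have hdiag : ∀ a b, M a a = M b b := by
    intro a b
    by_cases hab : a = b
    · rw [hab]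
    obtain ⟨σ, hσi, hσj⟩ := exists_perm_apply_eq_apply_eq hij hab
    have h1 := congrFun h σ
    rw [localOp_update_mulVec, localOp_update_mulVec, Finset.sum_eq_single (σ i),
      Finset.sum_eq_single (σ j), Function.update_eq_self, Function.update_eq_self] at h1
    · rw [← hσi, ← hσj]
      exact mul_right_cancel₀ (antisymmetricState_perm_ne_zero σ) h1
    · intro z _ hz
      rw [hzero σ j z hz, mul_zero]
    · simp
    · intro z _ hz
      rw [hzero σ i z hz, mul_zero]
    · simp
  refine ⟨M ⟨0, by omega⟩ ⟨0, by omega⟩, ?_⟩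
  ext a b
  by_cases hab : a = b
  · subst hab; simp [hdiag a ⟨0, by omega⟩]
  · simp [hab, hoff a b hab]

theorem symmetryGroup_antisymmetricState_subset {n : ℕ} (hn : 3 ≤ n) :
    symmetryGroup (antisymmetricState n) ⊆ tensorPowers n n := by
  rintro _ ⟨⟨S, rfl⟩, hS⟩
  have hSu : ∀ k, IsUnit (S k : Matrix (Fin n) (Fin n) ℂ) := fun k => (S k).isUnit
  have hinv : ∀ k, (S k : Matrix (Fin n) (Fin n) ℂ)⁻¹ * (S k : Matrix (Fin n) (Fin n) ℂ) = 1 :=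
    fun k => Matrix.nonsing_inv_mul _ ((Matrix.isUnit_iff_isUnit_det _).1 (hSu k))
  set i : Fin n := ⟨0, by omega⟩ with hi
  have hprop : ∀ j, ∃ a : ℂ, (S j : Matrix (Fin n) (Fin n) ℂ) = a • (S i).1 := by
    intro j
    by_cases hij : i = j
    · exact ⟨1, by rw [← hij, one_smul]⟩
    have hsw := localOp_comp_swap_mulVec_antisymmetricState hij hS
    set M : Matrix (Fin n) (Fin n) ℂ := (S i : Matrix (Fin n) (Fin n) ℂ)⁻¹ * (S j : Matrix (Fin n) (Fin n) ℂ) with hM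
    have key : localOp (Function.update (fun _ => 1) i M) *ᵥ antisymmetricState n =
        localOp (Function.update (fun _ => 1) j M) *ᵥ antisymmetricState n := by
      -- cancel the common symmetry `S` from both sides of `S φ = (S ∘ swap i j) φ`, then apply `M`
      -- at `j`
      set L : Fin n → Matrix (Fin n) (Fin n) ℂ := fun k =>
        Function.update (fun _ => 1) j M k * (S k : Matrix (Fin n) (Fin n) ℂ)⁻¹ with hL
      have h1 : localOp (fun k => L k * (S k : Matrix (Fin n) (Fin n) ℂ)) *ᵥ antisymmetricState n =
          localOp (fun k => L k * (S (Equiv.swap i j k) : Matrix (Fin n) (Fin n) ℂ)) *ᵥ antisymmetricState n := by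
        rw [← localOp_mulVec_mulVec L, ← localOp_mulVec_mulVec L, hS, hsw]
      rw [show (fun k => L k * (S k : Matrix (Fin n) (Fin n) ℂ)) =
          Function.update (fun _ => 1) j M by
        funext k; rw [hL, Matrix.mul_assoc, hinv, Matrix.mul_one]] at h1
      rw [h1]
      congr 2
      funext k
      by_cases hki : k = i
      · subst hki
        simp [hL, hij, hM]
      by_cases hkj : k = j
      · subst hkj
        simp only [hL, hM, Function.update_self, Equiv.swap_apply_right,
          Function.update_of_ne hki]
        rw [Matrix.mul_nonsing_inv_cancel_right _ _ ((Matrix.isUnit_iff_isUnit_det _).1 (hSu k)),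
          hinv]
      · simp only [hL, Function.update_of_ne hki, Function.update_of_ne hkj,
          Equiv.swap_apply_of_ne_of_ne hki hkj, Matrix.one_mul, hinv]
    obtain ⟨a, ha⟩ := exists_eq_smul_one_of_antisymmetricState hn hij key
    refine ⟨a, ?_⟩
    rw [← Matrix.mul_nonsing_inv_cancel_left _ (S j : Matrix (Fin n) (Fin n) ℂ)
      ((Matrix.isUnit_iff_isUnit_det _).1 (hSu i)), ← hM, ha, mul_smul_comm, Matrix.mul_one]
  choose a ha using hprop
  have : Nonempty (Fin n) := ⟨i⟩
  have hane : ∀ k, a k ≠ 0 := fun k h0 => (hSu k).ne_zero (by rw [ha k, h0, zero_smul])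
  -- the product of the scalars `a k` is spread evenly over the `n` factors as an `n`-th root
  obtain ⟨z, hz⟩ := IsAlgClosed.exists_pow_nat_eq (∏ k, a k) (by omega : 0 < n)
  have hz0 : z ≠ 0 := by
    rintro rfl
    rw [zero_pow (by omega)] at hz
    exact Finset.prod_ne_zero_iff.2 (fun k _ => hane k) hz.symm
  refine ⟨((hSu i).smul (Units.mk0 z hz0)).unit, ?_⟩
  rw [show (fun k => (S k : Matrix (Fin n) (Fin n) ℂ)) = fun k => a k • (S i).1 from funext ha,
    localOp_smul, ← hz]
  have := localOp_smul (fun _ : Fin n => z) (fun _ => (S i : Matrix (Fin n) (Fin n) ℂ))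
  rw [Finset.prod_const, Finset.card_univ, Fintype.card_fin] at this
  exact this.symm

theorem theorem4 :
    (∀ n d : ℕ, 4 ≤ n → 2 ≤ d → ∀ ψ : QState n d,
      symmetryGroup ψ ⊆ tensorPowers n d →
        ∃ φ ∈ sloccClass ψ, IsWeaklyIsolated φ) ∧
    (∀ n : ℕ, 4 ≤ n →
      ∃ φ ∈ sloccClass (antisymmetricState n), IsWeaklyIsolated φ) := by
  have general : ∀ n d : ℕ, 4 ≤ n → 2 ≤ d → ∀ ψ : QState n d,
      symmetryGroup ψ ⊆ tensorPowers n d → ∃ φ ∈ sloccClass ψ, IsWeaklyIsolated φ := by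
    intro n d hn hd ψ hψ
    obtain ⟨φ, hmem, hφ⟩ := exists_isRigid_mem_sloccClass hn (by omega) hψ
    exact ⟨φ, hmem, hφ.isWeaklyIsolated (by omega) hd⟩
  exact ⟨general, fun n hn => general n n hn (by omega) _
    (symmetryGroup_antisymmetricState_subset (by omega))⟩
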